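/- **Theorem 5.5.** Let $k$ be a field and let $\mathcal{C}$ be a $\operatorname{Hom}$-finite, Krull–Schmidt, triangulated $k$-category with suspension functor $\Sigma$. Let $R$ be a rigid object of $\mathcal{C}$, i.e. $\operatorname{Hom}_{\mathcal{C}}(R,\Sigma R)=0$. For an object $X$ let $\operatorname{add}X$ be the full subcategory of objects isomorphic to direct summands of finite direct sums of copies of $X$. Let $\mathcal{X}_R$ be the full subcategory of objects $Y$ with $\operatorname{Hom}_{\mathcal{C}}(R,Y)=0$, and let $\mathcal{C}(R)=\operatorname{add}R*\operatorname{add}\Sigma R$ be the full subcategory of objects $X$ for which there is a distinguished triangle $U\to X\to V\to\Sigma U$ with $U\in\operatorname{add}R$ and $V\in\operatorname{add}\Sigma R$. For a full subcategory $\mathcal{A}$ closed under finite direct sums, let $[\mathcal{A}]$ denote the ideal of morphisms that factor through an object of $\mathcal{A}$, and consider the ideal quotients $\mathcal{C}(R)/[\operatorname{add}\Sigma R]$ and $\mathcal{C}/[\mathcal{X}_R]$. Let $\mathcal{R}$ be the class of regular (i.e. simultaneously monic and epic) morphisms of $\mathcal{C}/[\mathcal{X}_R]$, and let $L_{\mathcal{R}}\colon\mathcal{C}/[\mathcal{X}_R]\to(\mathcal{C}/[\mathcal{X}_R])_{\mathcal{R}}$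 be the (Gabriel–Zisman) localisation functor. Then there is an additive functor $$F\colon\mathcal{C}(R)/[\operatorname{add}\Sigma R]\longrightarrow\mathcal{C}/[\mathcal{X}_R]$$ such that the composition $$L_{\mathcal{R}}\circ F\colon\mathcal{C}(R)/[\operatorname{add}\Sigma R]\longrightarrow(\mathcal{C}/[\mathcal{X}_R])_{\mathcal{R}}$$ is an equivalence of categories. -/

import Mathlib

open CategoryTheory CategoryTheory.Limits CategoryTheory.Pretriangulated
open scoped ZeroObject

universe w v u

namespace RigidLocalisation

section IdealQuotients

variable {D : Type u} [Category.{v} D] [Preadditive D]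

/-- The morphism `f` factors through an object of the (full) subcategory `A`. -/
def FactorsThrough (A : ObjectProperty D) {X Y : D} (f : X ⟶ Y) : Prop :=
  ∃ (Z : D) (_ : A Z) (a : X ⟶ Z) (b : Z ⟶ Y), a ≫ b = f

/-- Two parallel morphisms are identified when their difference lies in the ideal `[A]` of
morphisms that factor through an object of `A`. -/
def idealRel (A : ObjectProperty D) : HomRel D :=
  fun _ _ f g => FactorsThrough A (f - g)

/-- A full subcategory is closed under finite direct sums: it is non-empty, and any two of its
objects have a direct sum that lies in it. This is what makes `[A]` a (two-sided) ideal. -/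
class ClosedUnderDirectSums (A : ObjectProperty D) : Prop where
  nonempty : ∃ Z, A Z
  sum : ∀ X Y : D, A X → A Y → ∃ b : BinaryBicone X Y, Nonempty b.IsBilimit ∧ A b.pt

lemma FactorsThrough.add {A : ObjectProperty D} [ClosedUnderDirectSums A] {X Y : D}
    {f g : X ⟶ Y} (hf : FactorsThrough A f) (hg : FactorsThrough A g) :
    FactorsThrough A (f + g) := by
  obtain ⟨Z, hZ, a, b, rfl⟩ := hf
  obtain ⟨Z', hZ', a', b', rfl⟩ := hg
  obtain ⟨s, -, hs⟩ := ClosedUnderDirectSums.sum Z Z' hZ hZ'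
  exact ⟨s.pt, hs, a ≫ s.inl + a' ≫ s.inr, s.fst ≫ b + s.snd ≫ b', by simp⟩

lemma FactorsThrough.neg {A : ObjectProperty D} {X Y : D} {f : X ⟶ Y}
    (hf : FactorsThrough A f) : FactorsThrough A (-f) := by
  obtain ⟨Z, hZ, a, b, rfl⟩ := hf
  exact ⟨Z, hZ, -a, b, by simp⟩

lemma FactorsThrough.zero (A : ObjectProperty D) [ClosedUnderDirectSums A] (X Y : D) :
    FactorsThrough A (0 : X ⟶ Y) := by
  obtain ⟨Z, hZ⟩ := ClosedUnderDirectSums.nonempty (A := A)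
  exact ⟨Z, hZ, 0, 0, by simp⟩

instance (A : ObjectProperty D) [ClosedUnderDirectSums A] : Congruence (idealRel A) where
  comp_left := by
    rintro X Y Z f g g' ⟨W, hW, a, b, h⟩
    exact ⟨W, hW, f ≫ a, b, by rw [Category.assoc, h, Preadditive.comp_sub]⟩
  comp_right := by
    rintro X Y Z f f' g ⟨W, hW, a, b, h⟩
    exact ⟨W, hW, a, b ≫ g, by rw [← Category.assoc, h, Preadditive.sub_comp]⟩
  equivalence :=
    { refl := fun f => by
        simpa [idealRel] using FactorsThrough.zero A _ _
      symm := fun {f g} h => by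
        simpa [idealRel] using FactorsThrough.neg h
      trans := fun {f g k} h h' => by
        simpa [idealRel] using FactorsThrough.add h h' }

/-- The ideal quotient `D/[A]`: the objects are those of `D`, and the morphisms `X ⟶ Y` are the
cosets `f + [A](X, Y)`. -/
abbrev IdealQuotient (A : ObjectProperty D) [ClosedUnderDirectSums A] :=
  CategoryTheory.Quotient (idealRel A)

/-- The addition of morphisms of `D/[A]` is the one induced from `D`. -/
instance (A : ObjectProperty D) [ClosedUnderDirectSums A] : Preadditive (IdealQuotient A) :=
  CategoryTheory.Quotient.preadditive (idealRel A) (by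
    intro X Y f₁ f₂ g₁ g₂ hf hg
    have h := FactorsThrough.add hf hg
    rwa [show f₁ - f₂ + (g₁ - g₂) = f₁ + g₁ - (f₂ + g₂) by abel] at h)

end IdealQuotients

/-- The class of regular morphisms: those that are both monic and epic. -/
def regularMorphisms (D : Type u) [Category.{v} D] : MorphismProperty D :=
  MorphismProperty.monomorphisms D ⊓ MorphismProperty.epimorphisms D

/-- A `k`-linear category is Hom-finite when all its Hom spaces are finite-dimensional. -/
def HomFinite (k : Type w) [Field k] (C : Type u) [Category.{v} C] [Preadditive C]
    [Linear k C] : Prop :=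
  ∀ X Y : C, FiniteDimensional k (X ⟶ Y)

/-- An additive category is Krull–Schmidt when every object is isomorphic to a finite direct sum
of objects with local endomorphism rings. -/
def KrullSchmidt (C : Type u) [Category.{v} C] [Preadditive C] [HasFiniteBiproducts C] : Prop :=
  ∀ X : C, ∃ (n : ℕ) (Y : Fin n → C),
    (∀ i, IsLocalRing (End (Y i))) ∧ Nonempty (X ≅ ⨁ Y)

section Additive

variable {C : Type u} [Category.{v} C] [Preadditive C] [HasFiniteBiproducts C]

/-- `add X`: the objects that are isomorphic to a direct summand of a finite direct sum of copies
of `X`. A direct summand is expressed as a retract; in a triangulated category every split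
monomorphism has a complement, so the two notions agree. -/
def addClosure (X : C) : ObjectProperty C :=
  fun Y => ∃ n : ℕ, Nonempty (Retract Y (⨁ fun _ : Fin n => X))

lemma addClosure_iff (X Y : C) :
    addClosure X Y ↔ ∃ (n : ℕ) (a : Fin n → (Y ⟶ X)) (b : Fin n → (X ⟶ Y)),
      ∑ j, a j ≫ b j = 𝟙 Y := by
  constructor
  · rintro ⟨n, ⟨h⟩⟩
    refine ⟨n, fun j => h.i ≫ biproduct.π (fun _ : Fin n => X) j, fun j => biproduct.ι (fun _ : Fin n => X) j ≫ h.r, ?_⟩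
    have e : h.i ≫ (∑ j, biproduct.π (fun _ : Fin n => X) j ≫
        biproduct.ι (fun _ : Fin n => X) j) ≫ h.r = 𝟙 Y := by
      rw [biproduct.total, Category.id_comp, h.retract]
    rw [← e, Preadditive.sum_comp, Preadditive.comp_sum]
    simp
  · rintro ⟨n, a, b, h⟩
    have e : biproduct.lift a ≫ biproduct.desc b = 𝟙 Y := by
      rw [biproduct.lift_desc, h]
    exact ⟨n, ⟨⟨biproduct.lift a, biproduct.desc b, e⟩⟩⟩

lemma addClosure_biprod {X Y Z : C} [HasBinaryBiproduct Y Z] (hY : addClosure X Y)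
    (hZ : addClosure X Z) : addClosure X (Y ⊞ Z) := by
  rw [addClosure_iff] at hY hZ ⊢
  obtain ⟨n, a, b, h⟩ := hY
  obtain ⟨m, a', b', h'⟩ := hZ
  refine ⟨n + m, Fin.addCases (fun j => biprod.fst ≫ a j) (fun j => biprod.snd ≫ a' j),
    Fin.addCases (fun j => b j ≫ biprod.inl) (fun j => b' j ≫ biprod.inr), ?_⟩
  rw [Fin.sum_univ_add, ← biprod.total]
  congr 1
  · have e := congrArg (fun t => (biprod.fst : Y ⊞ Z ⟶ Y) ≫ t ≫ (biprod.inl : Y ⟶ Y ⊞ Z)) h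
    simpa [Preadditive.sum_comp, Preadditive.comp_sum] using e
  · have e := congrArg (fun t => (biprod.snd : Y ⊞ Z ⟶ Z) ≫ t ≫ (biprod.inr : Z ⟶ Y ⊞ Z)) h'
    simpa [Preadditive.sum_comp, Preadditive.comp_sum] using e

lemma addClosure_isZero {X Z : C} (hZ : IsZero Z) : addClosure X Z :=
  (addClosure_iff X Z).2 ⟨0, Fin.elim0, Fin.elim0, hZ.eq_of_src _ _⟩

end Additive

/-- `𝒳_X`: the objects `Y` with `Hom(X, Y) = 0`. -/
def homKernel {C : Type u} [Category.{v} C] [Preadditive C] (X : C) : ObjectProperty C :=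
  fun Y => ∀ f : X ⟶ Y, f = 0

section Triangulated

variable {C : Type u} [Category.{v} C] [Preadditive C] [HasZeroObject C] [HasShift C ℤ]
  [∀ n : ℤ, (shiftFunctor C n).Additive] [Pretriangulated C]

/-- The object `R` is rigid: `Ext¹(R, R) = Hom(R, ΣR) = 0`. -/
def IsRigid (R : C) : Prop :=
  ∀ f : R ⟶ R⟦(1 : ℤ)⟧, f = 0

/-- `add ΣR`, as a full subcategory of `C`. -/
abbrev addShift (R : C) : ObjectProperty C := addClosure (R⟦(1 : ℤ)⟧)

/-- `C(R) = add R * add ΣR`: the objects `X` for which there is a distinguished triangle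
`U ⟶ X ⟶ V ⟶ ΣU` with `U` in `add R` and `V` in `add ΣR`. -/
abbrev presented (R : C) : ObjectProperty C :=
  (addClosure R).extensionProduct (addShift R)

lemma addShift_le_presented (R : C) : addShift R ≤ presented R := fun X hX =>
  ⟨0, X, 0, 𝟙 X, 0, contractible_distinguished₁ X, addClosure_isZero (isZero_zero C), hX⟩

/-- `add ΣR`, as a full subcategory of `C(R)`, in which it is contained by
`addShift_le_presented`. -/
abbrev addShiftInPresented (R : C) : ObjectProperty (presented R).FullSubcategory :=
  (addShift R).inverseImage (presented R).ι

instance (R : C) : ClosedUnderDirectSums (homKernel R) where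
  nonempty := ⟨0, fun _ => (isZero_zero C).eq_of_tgt _ _⟩
  sum X Y hX hY := ⟨BinaryBiproduct.bicone X Y, ⟨BinaryBiproduct.isBilimit X Y⟩, fun f => by
    change R ⟶ X ⊞ Y at f
    apply biprod.hom_ext
    · rw [hX (f ≫ biprod.fst), zero_comp]
    · rw [hY (f ≫ biprod.snd), zero_comp]⟩

instance (R : C) : ClosedUnderDirectSums (addShiftInPresented R) where
  nonempty :=
    have h : addShift R (0 : C) := addClosure_isZero (isZero_zero C)
    ⟨⟨0, addShift_le_presented R _ h⟩, h⟩
  sum X Y hX hY := by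
    have h : addShift R (X.obj ⊞ Y.obj) := addClosure_biprod hX hY
    let b : BinaryBicone X Y :=
      { pt := ⟨X.obj ⊞ Y.obj, addShift_le_presented R _ h⟩
        fst := (presented R).homMk biprod.fst
        snd := (presented R).homMk biprod.snd
        inl := (presented R).homMk biprod.inl
        inr := (presented R).homMk biprod.inr
        inl_fst := by ext; exact biprod.inl_fst
        inl_snd := by ext; exact biprod.inl_snd
        inr_fst := by ext; exact biprod.inr_fst
        inr_snd := by ext; exact biprod.inr_snd }
    exact ⟨b, ⟨isBinaryBilimitOfTotal b ((presented R).hom_ext biprod.total)⟩, h⟩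

end Triangulated

end RigidLocalisation

namespace RigidLocalisation

section Additive

variable {C : Type u} [Category.{v} C] [Preadditive C] [HasFiniteBiproducts C]

/-! Everything is governed by Hom(R, -). A morphism lies in [𝒳_R] exactly when Hom(R, -) kills it
(`IsRigid.factorsThrough_homKernel_iff`), so a morphism of C/[𝒳_R] is regular exactly when Hom(R, -)
inverts it (`IsRigid.regularMorphisms_functor_map_iff`). The functor F induced by the inclusion of
C(R) is faithful because a morphism out of C(R) killed by Hom(R, -) already factors through add ΣR.
Objects of C(R) lift uniquely in C/[𝒳_R] along regular morphisms (`presented.exists_lift`), and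
every object receives a regular morphism from C(R) (`IsRigid.exists_presented`). So F has a right
adjoint that is a localisation at the regular morphisms, and F is a section of it up to isomorphism
(`isEquivalence_comp_Q`). -/

lemma addClosure_self (X : C) : addClosure X X :=
  (addClosure_iff X X).2 ⟨1, fun _ => 𝟙 X, fun _ => 𝟙 X, by simp⟩

lemma addClosure_biproduct (X : C) (n : ℕ) : addClosure X (⨁ fun _ : Fin n => X) :=
  ⟨n, ⟨Retract.refl _⟩⟩

/-- A morphism out of an object of `add R` vanishes if it is killed by all morphisms from `R`. -/
lemma addClosure.eq_zero {R U X : C} (hU : addClosure R U) (h : U ⟶ X)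
    (hh : ∀ f : R ⟶ U, f ≫ h = 0) : h = 0 := by
  obtain ⟨n, a, b, e⟩ := (addClosure_iff R U).1 hU
  rw [← Category.id_comp h, ← e, Preadditive.sum_comp]
  exact Finset.sum_eq_zero fun j _ => by rw [Category.assoc, hh, comp_zero]

/-- If every morphism from `R` lifts along `p`, so does every morphism from an object of
`add R`. -/
lemma addClosure.exists_lift {R U Y Z : C} (hU : addClosure R U) (p : Y ⟶ Z)
    (hp : ∀ f : R ⟶ Z, ∃ g : R ⟶ Y, g ≫ p = f) (f : U ⟶ Z) : ∃ g : U ⟶ Y, g ≫ p = f := by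
  obtain ⟨n, a, b, e⟩ := (addClosure_iff R U).1 hU
  choose g hg using fun j => hp (b j ≫ f)
  refine ⟨∑ j, a j ≫ g j, ?_⟩
  rw [Preadditive.sum_comp]
  simp_rw [Category.assoc, hg]
  simp_rw [← Category.assoc]
  rw [← Preadditive.sum_comp, e, Category.id_comp]

/-- Hom-finiteness provides right `add R`-approximations. -/
lemma HomFinite.exists_approximation {k : Type w} [Field k] [Linear k C] (hfin : HomFinite k C)
    (R X : C) : ∃ (U : C) (_ : addClosure R U) (p : U ⟶ X),
      ∀ f : R ⟶ X, ∃ g : R ⟶ U, g ≫ p = f := by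
  have := hfin R X
  obtain ⟨n, s, hs⟩ := Module.Finite.exists_fin (R := k) (M := R ⟶ X)
  refine ⟨_, addClosure_biproduct R n, biproduct.desc s, fun f => ?_⟩
  obtain ⟨c, hc⟩ := (Submodule.mem_span_range_iff_exists_fun k).1
    (show f ∈ Submodule.span k (Set.range s) by rw [hs]; trivial)
  refine ⟨biproduct.lift fun j => c j • 𝟙 R, ?_⟩
  rw [biproduct.lift_desc, ← hc]
  simp

omit [HasFiniteBiproducts C] in
lemma FactorsThrough.comp_eq_zero {R X Y : C} {h : X ⟶ Y}
    (hh : FactorsThrough (homKernel R) h) (f : R ⟶ X) : f ≫ h = 0 := by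
  obtain ⟨Z, hZ, a, b, rfl⟩ := hh
  rw [← Category.assoc, hZ (f ≫ a), zero_comp]

end Additive

/-! ### Triangles and Hom(R, -) -/

section Triangulated

variable {C : Type u} [Category.{v} C] [Preadditive C] [HasZeroObject C] [HasShift C ℤ]
  [∀ n : ℤ, (shiftFunctor C n).Additive] [Pretriangulated C] {R : C}

section Exactness

variable {X Y Z W : C} {f : X ⟶ Y} {g : Y ⟶ Z} {h : Z ⟶ X⟦(1 : ℤ)⟧}
  (hT : Triangle.mk f g h ∈ distTriang C)

include hT

lemma exists_comp_eq_of_mor₁_comp_eq_zero (u : Y ⟶ W) (hu : f ≫ u = 0) :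
    ∃ v : Z ⟶ W, g ≫ v = u :=
  (Triangle.yoneda_exact₂ _ hT u hu).imp fun _ => Eq.symm

lemma exists_comp_eq_of_comp_mor₂_eq_zero (u : W ⟶ Y) (hu : u ≫ g = 0) :
    ∃ v : W ⟶ X, v ≫ f = u :=
  (Triangle.coyoneda_exact₂ _ hT u hu).imp fun _ => Eq.symm

lemma exists_comp_eq_of_comp_mor₃_eq_zero (u : W ⟶ Z) (hu : u ≫ h = 0) :
    ∃ v : W ⟶ Y, v ≫ g = u :=
  (Triangle.coyoneda_exact₃ _ hT u hu).imp fun _ => Eq.symm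

lemma exists_comp_eq_of_mor₃_comp_shift_eq_zero (u : X ⟶ W) (hu : h ≫ u⟦(1 : ℤ)⟧' = 0) :
    ∃ v : Y ⟶ W, f ≫ v = u := by
  obtain ⟨w, hw⟩ : ∃ w : Y⟦(1 : ℤ)⟧ ⟶ W⟦(1 : ℤ)⟧, u⟦(1 : ℤ)⟧' = (-f⟦(1 : ℤ)⟧') ≫ w :=
    Triangle.yoneda_exact₃ _ (rot_of_distTriang _ hT) (u⟦(1 : ℤ)⟧') hu
  obtain ⟨v, rfl⟩ := (shiftFunctor C (1 : ℤ)).map_surjective w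
  -- The sign undoes the one that rotation puts on `f⟦1⟧'`.
  refine ⟨-v, (shiftFunctor C (1 : ℤ)).map_injective ?_⟩
  rw [hw]
  simp

end Exactness

lemma addClosure.shift {U : C} (hU : addClosure R U) : addShift R (U⟦(1 : ℤ)⟧) := by
  obtain ⟨n, a, b, e⟩ := (addClosure_iff R U).1 hU
  refine (addClosure_iff _ _).2 ⟨n, fun j => (a j)⟦1⟧', fun j => (b j)⟦1⟧', ?_⟩
  simp_rw [← Functor.map_comp]
  rw [← Functor.map_sum, e, CategoryTheory.Functor.map_id]

lemma IsRigid.homKernel_of_addShift (hR : IsRigid R) {V : C} (hV : addShift R V) :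
    homKernel R V := by
  intro f
  obtain ⟨n, a, b, e⟩ := (addClosure_iff _ V).1 hV
  rw [← Category.comp_id f, ← e, Preadditive.comp_sum]
  exact Finset.sum_eq_zero fun j _ => by rw [← Category.assoc, hR (f ≫ a j), zero_comp]

lemma addClosure.presented {U : C} (hU : addClosure R U) : presented R U :=
  ⟨U, 0, 𝟙 U, 0, 0, contractible_distinguished U, hU, addClosure_isZero (isZero_zero C)⟩

/-- The third object of a triangle on an `R`-surjective morphism from `add R` lies in `𝒳_R`. -/
lemma IsRigid.homKernel_obj₃ (hR : IsRigid R) {T : Triangle C} (hT : T ∈ distTriang C)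
    (hU : addClosure R T.obj₁) (hp : ∀ f : R ⟶ T.obj₂, ∃ g : R ⟶ T.obj₁, g ≫ T.mor₁ = f) :
    homKernel R T.obj₃ := by
  intro f
  obtain ⟨g, rfl⟩ := T.coyoneda_exact₃ hT f (hR.homKernel_of_addShift hU.shift _)
  obtain ⟨g', rfl⟩ := hp g
  rw [Category.assoc, comp_distTriang_mor_zero₁₂ _ hT, comp_zero]

section HomFinite

variable {k : Type w} [Field k] [Linear k C] (hfin : HomFinite k C)

include hfin

/-- A morphism killed by Hom(R, -) kills a right add R-approximation of its source, hence factors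
through the cone, which rigidity puts in 𝒳_R. -/
lemma IsRigid.factorsThrough_homKernel_iff (hR : IsRigid R) {X Y : C} (h : X ⟶ Y) :
    FactorsThrough (homKernel R) h ↔ ∀ f : R ⟶ X, f ≫ h = 0 := by
  refine ⟨FactorsThrough.comp_eq_zero, fun hh => ?_⟩
  obtain ⟨U, hU, p, hp⟩ := hfin.exists_approximation R X
  obtain ⟨Z, q, r, hT⟩ := distinguished_cocone_triangle p
  obtain ⟨h', rfl⟩ := exists_comp_eq_of_mor₁_comp_eq_zero hT h
    (hU.eq_zero _ fun f => by rw [← Category.assoc]; exact hh (f ≫ p))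
  exact ⟨Z, hR.homKernel_obj₃ hT hU hp, q, h', rfl⟩

/-- Every object receives a morphism from an object of `C(R)` that `Hom(R, -)` inverts. -/
lemma IsRigid.exists_presented (hR : IsRigid R) (X : C) :
    ∃ (X' : C) (_ : presented R X') (s : X' ⟶ X),
      Function.Bijective fun f : R ⟶ X' => f ≫ s := by
  obtain ⟨U, hU, p, hp⟩ := hfin.exists_approximation R X
  obtain ⟨Y, i, r, hT⟩ := distinguished_cocone_triangle₁ p
  -- Approximating the fibre `Y` of `p` as well gives a presentation U' ⟶ U of Hom(R, X); its cone
  -- is the required object.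
  obtain ⟨U', hU', p', hp'⟩ := hfin.exists_approximation R Y
  obtain ⟨X', j, d, hT'⟩ := distinguished_cocone_triangle (p' ≫ i)
  have hip : i ≫ p = 0 := comp_distTriang_mor_zero₁₂ _ hT
  obtain ⟨s, hs⟩ := exists_comp_eq_of_mor₁_comp_eq_zero hT' p (by
    rw [Category.assoc, hip, comp_zero])
  refine ⟨X', ⟨U, _, j, d, _, rot_of_distTriang _ hT', hU, hU'.shift⟩, s, ?_, ?_⟩
  · intro f g hfg
    have h0 : (f - g) ≫ s = 0 := by rw [Preadditive.sub_comp]; exact sub_eq_zero.2 hfg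
    obtain ⟨t, ht⟩ := exists_comp_eq_of_comp_mor₃_eq_zero hT' (f - g)
      (hR.homKernel_of_addShift hU'.shift _)
    obtain ⟨y, hy⟩ := exists_comp_eq_of_comp_mor₂_eq_zero hT t (by
      rw [← hs, ← Category.assoc, ht, h0])
    obtain ⟨z, rfl⟩ := hp' y
    have hj : (p' ≫ i) ≫ j = 0 := comp_distTriang_mor_zero₁₂ _ hT'
    rw [← sub_eq_zero, ← ht, ← hy, Category.assoc, Category.assoc, ← Category.assoc p', hj,
      comp_zero]
  · intro f
    obtain ⟨g, rfl⟩ := hp f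
    exact ⟨g ≫ j, by simp [hs]⟩

end HomFinite

/-- A morphism out of an object of `C(R)` that `Hom(R, -)` kills factors through `add ΣR`. -/
lemma presented.factorsThrough_addShift {X Y : C} (hX : presented R X) (h : X ⟶ Y)
    (hh : ∀ f : R ⟶ X, f ≫ h = 0) : FactorsThrough (addShift R) h := by
  obtain ⟨U, V, i, q, d, hT, hU, hV⟩ := hX
  obtain ⟨h', e⟩ := exists_comp_eq_of_mor₁_comp_eq_zero hT h
    (hU.eq_zero _ fun f => by rw [← Category.assoc]; exact hh _)
  exact ⟨V, hV, q, h', e⟩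

/-- A morphism from an object of `C(R)` lifts, up to a morphism killed by `Hom(R, -)`, along any
morphism that `Hom(R, -)` inverts. -/
lemma presented.exists_lift (hR : IsRigid R) {X : C} (hX : presented R X) {Y Z : C} (s : Y ⟶ Z)
    (hs : Function.Bijective fun f : R ⟶ Y => f ≫ s) (g : X ⟶ Z) :
    ∃ g' : X ⟶ Y, ∀ f : R ⟶ X, f ≫ g' ≫ s = f ≫ g := by
  obtain ⟨U, V, i, q, d, hT, hU, hV⟩ := hX
  obtain ⟨u, hu⟩ := hU.exists_lift s hs.2 (i ≫ g)
  -- This is the obstruction to extending `u` from `U` to `X`. Tested on ΣR it desuspends to some R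
  -- ⟶ Y killed by `s`, and `s` is injective on these.
  have hdu : d ≫ u⟦(1 : ℤ)⟧' = 0 := by
    refine addClosure.eq_zero hV _ fun f => ?_
    obtain ⟨t, ht⟩ := (shiftFunctor C (1 : ℤ)).map_surjective (f ≫ d ≫ u⟦(1 : ℤ)⟧')
    have hdi : d ≫ i⟦(1 : ℤ)⟧' = 0 := comp_distTriang_mor_zero₃₁ _ hT
    have hts : t ≫ s = 0 := by
      apply (shiftFunctor C (1 : ℤ)).map_injective
      rw [Functor.map_comp, ht, Category.assoc, Category.assoc, ← Functor.map_comp, hu,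
        Functor.map_comp, reassoc_of% hdi, zero_comp, comp_zero, Functor.map_zero]
    have : t = 0 := hs.1 (by simpa using hts)
    rw [← ht, this, Functor.map_zero]
  obtain ⟨g', hg'⟩ := exists_comp_eq_of_mor₃_comp_shift_eq_zero hT u hdu
  refine ⟨g', fun f => ?_⟩
  obtain ⟨t, rfl⟩ := exists_comp_eq_of_comp_mor₂_eq_zero hT f (hR.homKernel_of_addShift hV _)
  rw [Category.assoc, Category.assoc, ← hu, reassoc_of% hg']

end Triangulated

/-! ### Coreflective subcategories and localisation -/

section Coreflection

universe v₁ v₂ u₁ u₂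

/-- A fully faithful functor with right approximations in a class `W` of morphisms, consisting of
the colocal morphisms with respect to its image, becomes an equivalence after localisation
at `W`. -/
lemma isEquivalence_comp_Q {A : Type u₁} [Category.{v₁} A] {D : Type u₂} [Category.{v₂} D]
    (F : A ⥤ D) [F.Full] [F.Faithful] (W : MorphismProperty D)
    (hW : W = ObjectProperty.isColocal (· ∈ Set.range F.obj))
    (happrox : ∀ Y : D, ∃ (X : A) (s : F.obj X ⟶ Y), W s) : (F ⋙ W.Q).IsEquivalence := by
  choose G s hs using happrox
  let e (X : A) (Y : D) : (F.obj X ⟶ Y) ≃ (X ⟶ G Y) :=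
    (((Functor.FullyFaithful.ofFullyFaithful F).homEquiv).trans
      (Equiv.ofBijective (fun f : F.obj X ⟶ F.obj (G Y) => f ≫ s Y)
        ((hW ▸ hs Y) _ ⟨X, rfl⟩))).symm
  have he : ∀ X' X Y (f : X' ⟶ X) (g : F.obj X ⟶ Y), e X' Y (F.map f ≫ g) = f ≫ e X Y g := by
    intro X' X Y f g
    obtain ⟨g, rfl⟩ := (e X Y).symm.surjective g
    rw [Equiv.apply_symm_apply, ← Equiv.eq_symm_apply]
    simp [e, Functor.FullyFaithful.homEquiv]
  let adj := Adjunction.adjunctionOfEquivRight e he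
  have : (Adjunction.rightAdjointOfEquiv e he).IsLocalization W := by
    rw [hW]
    exact ObjectProperty.isLocalization_isColocal adj
  let E := Localization.uniq W.Q (Adjunction.rightAdjointOfEquiv e he) W
  have i : (F ⋙ W.Q) ⋙ E.functor ≅ 𝟭 A :=
    Functor.associator _ _ _ ≪≫
      Functor.isoWhiskerLeft F (Localization.compUniqFunctor W.Q _ W) ≪≫ (asIso adj.unit).symm
  have : ((F ⋙ W.Q) ⋙ E.functor).IsEquivalence := Functor.isEquivalence_of_iso i.symm
  exact Functor.isEquivalence_of_comp_right _ E.functor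

end Coreflection

/-! ### Regular morphisms in the ideal quotient -/

section Triangulated

variable {C : Type u} [Category.{v} C] [Preadditive C] [HasZeroObject C] [HasShift C ℤ]
  [∀ n : ℤ, (shiftFunctor C n).Additive] [Pretriangulated C] {R : C}

/-- The functor `C(R)/[add ΣR] ⥤ C/[𝒳_R]` induced by the inclusion of `C(R)`. -/
def presentedFunctor (hR : IsRigid R) :
    IdealQuotient (addShiftInPresented R) ⥤ IdealQuotient (homKernel R) :=
  CategoryTheory.Quotient.lift _ ((presented R).ι ⋙ Quotient.functor (idealRel (homKernel R))) (by
    rintro X Y f g ⟨Z, hZ, a, b, h⟩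
    exact CategoryTheory.Quotient.sound _ ⟨Z.obj, hR.homKernel_of_addShift hZ, a.hom, b.hom,
      congrArg (fun t => t.hom) h⟩)

lemma presentedFunctor_additive (hR : IsRigid R) : (presentedFunctor hR).Additive where
  map_add := by
    rintro ⟨X⟩ ⟨Y⟩ ⟨f⟩ ⟨g⟩
    rfl

lemma presentedFunctor_full (hR : IsRigid R) : (presentedFunctor hR).Full where
  map_surjective := by
    rintro ⟨X⟩ ⟨Y⟩ ⟨f⟩
    exact ⟨(Quotient.functor _).map ((presented R).homMk f), rfl⟩

lemma presentedFunctor_faithful (hR : IsRigid R) : (presentedFunctor hR).Faithful where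
  map_injective := by
    rintro ⟨X⟩ ⟨Y⟩ ⟨f⟩ ⟨g⟩ h
    have h' : FactorsThrough (homKernel R) (f.hom - g.hom) :=
      (Quotient.functor_map_eq_iff (idealRel (homKernel R)) f.hom g.hom).1 h
    obtain ⟨Z, hZ, a, b, e⟩ := presented.factorsThrough_addShift X.property _ h'.comp_eq_zero
    exact CategoryTheory.Quotient.sound _ ⟨⟨Z, addShift_le_presented R _ hZ⟩, hZ,
      (presented R).homMk a, (presented R).homMk b, (presented R).hom_ext e⟩

section HomFinite

variable {k : Type w} [Field k] [Linear k C] (hfin : HomFinite k C) (hR : IsRigid R)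

include hfin hR

lemma IsRigid.functor_map_eq_iff {X Y : C} (f g : X ⟶ Y) :
    (Quotient.functor (idealRel (homKernel R))).map f =
      (Quotient.functor (idealRel (homKernel R))).map g ↔ ∀ r : R ⟶ X, r ≫ f = r ≫ g := by
  rw [Quotient.functor_map_eq_iff]
  refine (hR.factorsThrough_homKernel_iff hfin _).trans (forall_congr' fun r => ?_)
  rw [Preadditive.comp_sub, sub_eq_zero]

lemma IsRigid.mono_functor_map_iff {X Y : C} (f : X ⟶ Y) :
    Mono ((Quotient.functor (idealRel (homKernel R))).map f) ↔
      Function.Injective fun r : R ⟶ X => r ≫ f := by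
  constructor
  · intro _ a b hab
    have h : (Quotient.functor (idealRel (homKernel R))).map a =
        (Quotient.functor (idealRel (homKernel R))).map b := by
      rw [← cancel_mono ((Quotient.functor (idealRel (homKernel R))).map f),
        ← Functor.map_comp, ← Functor.map_comp]
      exact congrArg _ hab
    -- Testing at `𝟙 R` shows that no two distinct morphisms out of `R` are identified in the
    -- quotient.
    simpa using (hR.functor_map_eq_iff hfin a b).1 h (𝟙 R)
  · intro hf
    refine ⟨?_⟩
    rintro ⟨Z⟩ ⟨g⟩ ⟨h⟩ e
    refine (hR.functor_map_eq_iff hfin g h).2 fun r => hf ?_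
    simpa using (hR.functor_map_eq_iff hfin (g ≫ f) (h ≫ f)).1 e r

/-- If the class of `f` is epic, the map to its cone becomes zero in the quotient, so it kills every
morphism from `R`, and these all lift along `f`. -/
lemma IsRigid.epi_functor_map_iff {X Y : C} (f : X ⟶ Y) :
    Epi ((Quotient.functor (idealRel (homKernel R))).map f) ↔
      Function.Surjective fun r : R ⟶ X => r ≫ f := by
  constructor
  · intro _ r
    obtain ⟨Z, g, h, hT⟩ := distinguished_cocone_triangle f
    have hfg : f ≫ g = 0 := comp_distTriang_mor_zero₁₂ _ hT
    have hg : (Quotient.functor (idealRel (homKernel R))).map g =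
        (Quotient.functor (idealRel (homKernel R))).map 0 := by
      rw [← cancel_epi ((Quotient.functor (idealRel (homKernel R))).map f),
        ← Functor.map_comp, ← Functor.map_comp, hfg, comp_zero]
    exact exists_comp_eq_of_comp_mor₂_eq_zero hT r
      (((hR.functor_map_eq_iff hfin g 0).1 hg r).trans comp_zero)
  · intro hf
    refine ⟨?_⟩
    rintro ⟨Z⟩ ⟨g⟩ ⟨h⟩ e
    refine (hR.functor_map_eq_iff hfin g h).2 fun r => ?_
    obtain ⟨r, rfl⟩ := hf r
    simpa using (hR.functor_map_eq_iff hfin (f ≫ g) (f ≫ h)).1 e r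

lemma IsRigid.regularMorphisms_functor_map_iff {X Y : C} (f : X ⟶ Y) :
    regularMorphisms _ ((Quotient.functor (idealRel (homKernel R))).map f) ↔
      Function.Bijective fun r : R ⟶ X => r ≫ f :=
  and_congr (hR.mono_functor_map_iff hfin f) (hR.epi_functor_map_iff hfin f)

lemma IsRigid.regularMorphisms_eq_isColocal :
    regularMorphisms (IdealQuotient (homKernel R)) =
      ObjectProperty.isColocal (· ∈ Set.range (presentedFunctor hR).obj) := by
  ext ⟨Y⟩ ⟨Z⟩ ⟨s⟩
  refine (hR.regularMorphisms_functor_map_iff hfin s).trans ⟨?_, fun h => ?_⟩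
  · rintro hs _ ⟨⟨X⟩, rfl⟩
    refine ⟨?_, ?_⟩
    · rintro ⟨g⟩ ⟨h⟩ e
      refine (hR.functor_map_eq_iff hfin g h).2 fun r => hs.1 ?_
      simpa using (hR.functor_map_eq_iff hfin (g ≫ s) (h ≫ s)).1 e r
    · rintro ⟨g⟩
      obtain ⟨g', hg'⟩ := presented.exists_lift hR X.property s hs g
      refine ⟨(Quotient.functor _).map g', (hR.functor_map_eq_iff hfin (g' ≫ s) g).2 hg'⟩
  -- `R` itself lies in C(R), so colocality can be tested there.
  · obtain ⟨hi, hs⟩ := h ((Quotient.functor _).obj R)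
      ⟨⟨⟨R, (addClosure_self R).presented⟩⟩, rfl⟩
    refine ⟨fun a b hab => ?_, fun r => ?_⟩
    · simpa using (hR.functor_map_eq_iff hfin a b).1
        (hi (congrArg (Quotient.functor _).map hab)) (𝟙 R)
    · obtain ⟨⟨g⟩, hg⟩ := hs ((Quotient.functor _).map r)
      exact ⟨g, by simpa using (hR.functor_map_eq_iff hfin (g ≫ s) r).1 hg (𝟙 R)⟩

lemma IsRigid.isEquivalence_presentedFunctor_comp_Q :
    (presentedFunctor hR ⋙
      (regularMorphisms (IdealQuotient (homKernel R))).Q).IsEquivalence := by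
  have := presentedFunctor_full hR
  have := presentedFunctor_faithful hR
  refine isEquivalence_comp_Q _ _ (hR.regularMorphisms_eq_isColocal hfin) ?_
  rintro ⟨Y⟩
  obtain ⟨X, hX, s, hs⟩ := hR.exists_presented hfin Y
  exact ⟨⟨⟨X, hX⟩⟩, (Quotient.functor _).map s,
    (hR.regularMorphisms_functor_map_iff hfin s).2 hs⟩

end HomFinite

end Triangulated

end RigidLocalisation

theorem theorem5p5 (k : Type w) [Field k] (C : Type u) [Category.{v} C] [Preadditive C]
    [Linear k C] [HasZeroObject C] [HasShift C ℤ] [∀ n : ℤ, (shiftFunctor C n).Additive]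
    [∀ n : ℤ, (shiftFunctor C n).Linear k] [Pretriangulated C] [IsTriangulated C]
    (hfin : RigidLocalisation.HomFinite k C) (hKS : RigidLocalisation.KrullSchmidt C)
    (R : C) (hR : RigidLocalisation.IsRigid R) :
    ∃ F : RigidLocalisation.IdealQuotient (RigidLocalisation.addShiftInPresented R) ⥤
        RigidLocalisation.IdealQuotient (RigidLocalisation.homKernel R),
      F.Additive ∧
      (F ⋙ (RigidLocalisation.regularMorphisms
        (RigidLocalisation.IdealQuotient (RigidLocalisation.homKernel R))).Q).IsEquivalence :=
  ⟨RigidLocalisation.presentedFunctor hR, RigidLocalisation.presentedFunctor_additive hR,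
    hR.isEquivalence_presentedFunctor_comp_Q hfin⟩
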